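/- Let $\Omega=\{0,1\}^{\mathbb N}$ with the lexicographic order $\preceq$ and the shift $S(\omega_0\omega_1\omega_2\cdots)=\omega_1\omega_2\cdots$. A *decimal* is an expression $\omega_0\cdots\omega_N\bullet\omega_{N+1}\omega_{N+2}\cdots$ with $\omega\in\Omega$, where decimals that differ only by zeros at the left end of the integer part are identified; decimals are ordered by aligning their points (padding with zeros on the left) and comparing lexicographically. For a set $\Gamma$ of decimals, $\widehat\Gamma\subset\Omega$ is the set of strings obtained by removing the point from all expressions of elements of $\Gamma$; for $\Gamma\subset\Omega$, $\Gamma^\bullet$ is the set of decimals obtained by placing a point anywhere in strings of $\Gamma$ (also to the left of the string, inserting zeros). A *binary radix system* with base $B$ is a triple $(\Gamma,\pi,B)$ with a real $B>1$, a set $\Gamma$ of decimals with $[S^n(\widehat\Gamma)]^\bullet=\Gamma$ for all $n\ge 0$, and a strictly increasing bijection $\pi:\Gamma\to[0,\infty)$ with $\pi(\omega_0\cdots\omega_N\bullet\omega_{N+1}\cdots)=\sum_{n=-\infty}^{N}\omega_{N-n}B^n$. A pair $(\alpha,\beta)\in\Omega^2$ is *admissible* if $\alpha_0\alpha_1=01$,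 $\beta_0\beta_1=10$, and $S^n\alpha\notin(\alpha,\beta]$, $S^n\beta\notin[\alpha,\beta)$ for all $n\ge0$. Put $\Omega_{(\alpha,\beta,-)}=\{\omega: S^n\omega\notin(\alpha,\beta]\ \forall n\ge 0\}$, $\Omega_{(\alpha,\beta,+)}=\{\omega: S^n\omega\notin[\alpha,\beta)\ \forall n\ge 0\}$, $\Omega^\bullet_{(\alpha,\beta,-)}=\{\omega\in\Omega_{(\alpha,\beta,-)}:0\omega\preceq\alpha\}^\bullet$ and $\Omega^\bullet_{(\alpha,\beta,+)}=\{\omega\in\Omega_{(\alpha,\beta,+)}:0\omega\prec\alpha\}^\bullet$. The pair is *null* if $\limsup_{n\to\infty}\frac1n\ln|\Gamma_n|=0$ for $\Gamma=\Omega_{(\alpha,\beta,-)}\cup\Omega_{(\alpha,\beta,+)}$, where $\Gamma_n$ is the set of initial segments of length $n$ of strings in $\Gamma$. Let $B_{(\alpha,\beta)}=1/b$, where $b$ is the least $x\in[\frac12,1)$ with $\sum_{n\ge0}\alpha_nx^n=\sum_{n\ge0}\beta_nx^n$, and let $R(\alpha,\beta,\pm)=(\Omega^\bullet_{(\alpha,\beta,\pm)},\pi,B_{(\alpha,\beta)})$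 with $\pi(\omega_0\cdots\omega_N\bullet\omega_{N+1}\cdots)=\sum_{n=-\infty}^N\omega_{N-n}B_{(\alpha,\beta)}^n$. For $1<B<2$ and $1-\frac1B\le p\le\frac1B$ let $f_-(x)=Bx$ if $x\le p$ and $f_-(x)=Bx+1-B$ if $x>p$, and let $f_+(x)=Bx$ if $x<p$ and $f_+(x)=Bx+1-B$ if $x\ge p$ (for $x\in[0,1]$). Let $\alpha_p\in\Omega$ be the itinerary of $p$ under $f_-$, that is, $(\alpha_p)_k=0$ if $f_-^k(p)\le p$ and $1$ otherwise, and let $\beta_p$ be the itinerary of $p$ under $f_+$, that is, $(\beta_p)_k=0$ if $f_+^k(p)<p$ and $1$ otherwise. **Corollary.** Let $1<B<2$. There exist infinitely many distinct binary radix systems with base $B$. More precisely, for every $p\in[1-\frac1B,\frac1B]$ the pair $(\alpha_p,\beta_p)$ is admissible and not null; the number $\frac1B$ is the least solution $x\in[\frac12,1)$ of $\sum_n(\alpha_p)_nx^n=\sum_n(\beta_p)_nx^n$; and $R(\alpha_p,\beta_p,-)$ and $R(\alpha_p,\beta_p,+)$ are binary radix systems with base $B$. For each of the two signs, different $p\in[1-\frac1B,\frac1B]$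 give different systems $R(\alpha_p,\beta_p,\pm)$. -/

import Mathlib

open scoped NNReal

namespace BinaryRadix

/-! ### Strings and decimals -/

/-- Infinite strings `ω₀ ω₁ ω₂ ⋯` of zeros and ones.  The lexicographic order on them is Mathlib's
order on `Lex (ℕ → Fin 2)`, reached through `toLex`. -/
abbrev BinString : Type := ℕ → Fin 2

/-- The shift operator `S (ω₀ ω₁ ω₂ ⋯) = ω₁ ω₂ ⋯`. -/
def shift (ω : BinString) : BinString := fun k => ω (k + 1)

/-- The string `0 ω₀ ω₁ ω₂ ⋯`. -/
def consZero (ω : BinString) : BinString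
  | 0 => 0
  | k + 1 => ω k

/-- Decimals `ω₀ ⋯ ω_N • ω_{N+1} ω_{N+2} ⋯`, where decimals that differ only by zeros at the left
end of the integer part are the same decimal.  Such a class is given by its digit in every place:
`digit n` is the digit that belongs to the `n`-th power of the base, so that the decimal point
stands between the places `0` and `-1`; only finitely many places left of the point are nonzero. -/
@[ext]
structure Decimal : Type where
  digit : ℤ → Fin 2
  eventually_zero : ∃ N : ℤ, ∀ n : ℤ, N < n → digit n = 0

/-- `place ω k` is the string `ω` with a decimal point put after its first `k` entries:
`ω₀ ⋯ ω_{k-1} • ω_k ω_{k+1} ⋯`.  For negative `k` it is `• 0 ⋯ 0 ω₀ ω₁ ⋯` with `-k` zeros. -/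
def place (ω : BinString) (k : ℤ) : Decimal where
  digit n := if n < k then ω (k - 1 - n).toNat else 0
  eventually_zero := ⟨k, fun _ hn => if_neg (not_lt.mpr hn.le)⟩

/-- The set `Γ̂` of all strings that arise from decimals in `Γ` by removing the decimal point
(decimals may be written with additional zeros at the left end). -/
def hat (Γ : Set Decimal) : Set BinString := {ω | ∃ k : ℕ, place ω k ∈ Γ}

/-- The set `Γ^•` of all decimals that arise from strings in `Γ` by placing a decimal point
anywhere. -/
def withPoint (Γ : Set BinString) : Set Decimal := {σ | ∃ ω ∈ Γ, ∃ k : ℤ, σ = place ω k}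

/-- Shift invariance of a set of decimals: `[Sⁿ(Γ̂)]^• = Γ` for all `n ≥ 0`. -/
def ShiftInvariant (Γ : Set Decimal) : Prop :=
  ∀ n : ℕ, withPoint (shift^[n] '' hat Γ) = Γ

/-- The strict lexicographic order on decimals: the two decimals are aligned at the decimal point
(padded by zeros at the left) and then compared as strings. -/
def Decimal.LexLT (σ ω : Decimal) : Prop :=
  ∃ m : ℤ, (∀ n : ℤ, m < n → σ.digit n = ω.digit n) ∧ σ.digit m < ω.digit m

/-! ### Binary radix systems -/

/-- A triple `(Γ, π, B)` of a set of decimals, a map `π : Γ → [0, ∞)` and a real number. -/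
structure RadixTriple : Type where
  addressSpace : Set Decimal
  radixMap : addressSpace → ℝ≥0
  base : ℝ

/-- The triple `(Γ, π, B)` is a binary radix system. -/
structure RadixTriple.IsBinaryRadixSystem (R : RadixTriple) : Prop where
  one_lt_base : 1 < R.base
  shiftInvariant : ShiftInvariant R.addressSpace
  bijective : Function.Bijective R.radixMap
  strictly_increasing : ∀ σ ω : R.addressSpace, σ.1.LexLT ω.1 → R.radixMap σ < R.radixMap ω
  radixMap_eq : ∀ ω : R.addressSpace,
    HasSum (fun n : ℤ => ((ω.1.digit n : ℕ) : ℝ) * R.base ^ n) (R.radixMap ω : ℝ)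

/-! ### Admissible and null pairs, address spaces -/

/-- The two signs in `Ω_{(α,β,±)}`, `f_{(B,p,±)}` and `R(α,β,±)`. -/
inductive Side : Type
  | minus
  | plus

/-- The interval `(α, β]` for the sign `-`, and `[α, β)` for the sign `+`. -/
def gap (α β : BinString) : Side → Set BinString
  | .minus => {ω | toLex α < toLex ω ∧ toLex ω ≤ toLex β}
  | .plus => {ω | toLex α ≤ toLex ω ∧ toLex ω < toLex β}

/-- Admissible pairs of strings. -/
structure Admissible (α β : BinString) : Prop where
  left_zero : α 0 = 0
  left_one : α 1 = 1
  right_zero : β 0 = 1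
  right_one : β 1 = 0
  left_shift : ∀ n : ℕ, shift^[n] α ∉ gap α β .minus
  right_shift : ∀ n : ℕ, shift^[n] β ∉ gap α β .plus

/-- The address space `Ω_{(α,β,±)}` of strings. -/
def stringSpace (α β : BinString) (s : Side) : Set BinString :=
  {ω | ∀ n : ℕ, shift^[n] ω ∉ gap α β s}

/-- `Ω⁰_{(α,β,-)}` (condition `0ω ≼ α`) and `Ω⁰_{(α,β,+)}` (condition `0ω ≺ α`). -/
def stringSpaceZero (α β : BinString) : Side → Set BinString
  | .minus => {ω ∈ stringSpace α β .minus | toLex (consZero ω) ≤ toLex α}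
  | .plus => {ω ∈ stringSpace α β .plus | toLex (consZero ω) < toLex α}

/-- The address space `Ω^•_{(α,β,±)}` of decimals. -/
def decimalSpace (α β : BinString) (s : Side) : Set Decimal :=
  withPoint (stringSpaceZero α β s)

/-- The number `|Γ_n|` of initial segments of length `n` of strings in `Γ`. -/
noncomputable def wordCount (Γ : Set BinString) (n : ℕ) : ℕ :=
  Set.ncard ((fun (ω : BinString) (i : Fin n) => ω i) '' Γ)

/-- The exponential growth rate `limsup (1/n) ln |Γ_n|` of a nonempty set of strings (the sequence
is bounded between `0` and `ln 2`). -/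
noncomputable def growthRate (Γ : Set BinString) : ℝ :=
  Filter.limsup (fun n : ℕ => 1 / (n : ℝ) * Real.log (wordCount Γ n)) Filter.atTop

/-- The pair `(α, β)` is null: the growth rate of `Ω_{(α,β,-)} ∪ Ω_{(α,β,+)}` is zero. -/
def IsNull (α β : BinString) : Prop :=
  growthRate (stringSpace α β .minus ∪ stringSpace α β .plus) = 0

/-! ### The radix systems `R(α,β,±)` -/

/-- The solutions `x ∈ [1/2, 1)` of `∑ αₙ xⁿ = ∑ βₙ xⁿ`. -/
def solutions (α β : BinString) : Set ℝ :=
  {x | x ∈ Set.Ico (1 / 2 : ℝ) 1 ∧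
    ∑' n : ℕ, ((α n : ℕ) : ℝ) * x ^ n = ∑' n : ℕ, ((β n : ℕ) : ℝ) * x ^ n}

/-- The base `B_{(α,β)} = 1 / b`, where `b` is the minimum of `solutions α β`. -/
noncomputable def pairBase (α β : BinString) : ℝ := 1 / sInf (solutions α β)

theorem pairBase_nonneg (α β : BinString) : 0 ≤ pairBase α β :=
  one_div_nonneg.mpr (Real.sInf_nonneg fun _ hx => le_trans (by norm_num) hx.1.1)

/-- The value `∑ₙ ωₙ Bⁿ` of a decimal with digits `ωₙ` in a base `B ≥ 0`. -/
noncomputable def value (B : ℝ) (hB : 0 ≤ B) (ω : Decimal) : ℝ≥0 :=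
  ⟨∑' n : ℤ, ((ω.digit n : ℕ) : ℝ) * B ^ n,
    tsum_nonneg fun n => mul_nonneg (Nat.cast_nonneg _) (zpow_nonneg hB n)⟩

/-- The triple `R(α,β,±) = (Ω^•_{(α,β,±)}, π_{(α,β)}, B_{(α,β)})`. -/
noncomputable def pairSystem (α β : BinString) (s : Side) : RadixTriple where
  addressSpace := decimalSpace α β s
  radixMap := fun ω => value (pairBase α β) (pairBase_nonneg α β) ω.1
  base := pairBase α β

/-! ### Itineraries -/

open Classical in
/-- The digit of a point `x`: it is `0` iff `x ≤ p` (sign `-`), respectively `x < p` (sign `+`). -/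
noncomputable def digitOf (p : ℝ) : Side → ℝ → Fin 2
  | .minus => fun x => if x ≤ p then 0 else 1
  | .plus => fun x => if x < p then 0 else 1

/-- The map `f_{(B,p,±)}`: it is `x ↦ B x` where the digit of `x` is `0`, and
`x ↦ B x + (1 - B)` where it is `1`.  (For `1 < B ≤ 2` and `1 - 1/B ≤ p ≤ 1/B` it maps `[0,1]` to
itself; it is written here as a function on `ℝ`.) -/
noncomputable def stepMap (B p : ℝ) (s : Side) (x : ℝ) : ℝ :=
  if digitOf p s x = 0 then B * x else B * x + (1 - B)

/-- The itinerary of the point `y` under `f_{(B,p,±)}`. -/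
noncomputable def itinerary (B p : ℝ) (s : Side) (y : ℝ) : BinString :=
  fun k => digitOf p s ((stepMap B p s)^[k] y)

/-- `α_p`, the itinerary of `p` under `f_{(B,p,-)}`. -/
noncomputable def critLeft (B p : ℝ) : BinString := itinerary B p .minus p

/-- `β_p`, the itinerary of `p` under `f_{(B,p,+)}`. -/
noncomputable def critRight (B p : ℝ) : BinString := itinerary B p .plus p

end BinaryRadix

namespace BinaryRadix

/-! ### Power series of strings -/

/-! Rescale the value of a string in base `B` to a point of `[0,1]` (`expansion`). The shift then
acts by the two branches of the step map, both of slope `B`. So an itinerary expands back to its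
starting point (`expansion_itinerary`), and larger points have larger itineraries (`itinerary_lt`).
Conversely, a string whose shifts avoid the gap is the itinerary of its expansion
(`itinerary_expansion`). Each string space is thus an order copy of `[0,1]`. Admissibility, shift
invariance, and the bijectivity and monotonicity of the radix map are read off from this dictionary;
non-nullity follows from covering `[0,1]` by cylinders of length `B⁻ⁿ`. Distinct parameters are told
apart by how large an expansion a string with leading digit 0 can have.

Minimality of `1/B` is a separate analytic point (`powerValue_crit_ne`). Suppose both critical
strings have the same value at some `t < 1/B`. When the itinerary of `z` separates from a critical
one at time `n ≥ 1`, the two orbits straddle `p`: their distance has grown by `Bⁿ`, while the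
difference of values carries a weight `tⁿ`. A Lipschitz bound at `p` therefore improves by `(tB)ⁿ <
1`, again and again, so all itineraries have one common value. But the itinerary of `0` has value
`0`, and that of `p` has value at least `t`. -/

theorem fin_two_cases (d : Fin 2) : d = 0 ∨ d = 1 := by omega

theorem eq_zero_one_of_lt {a b : Fin 2} (h : a < b) : a = 0 ∧ b = 1 := by omega

theorem shift_iterate_apply (ω : BinString) (n k : ℕ) : shift^[n] ω k = ω (k + n) := by
  induction n generalizing ω with
  | zero => rfl
  | succ n ih => rw [Function.iterate_succ_apply, ih]; rfl

theorem toLex_lt_iff {ω η : BinString} :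
    toLex ω < toLex η ↔ ∃ n, (∀ i < n, ω i = η i) ∧ ω n < η n := Iff.rfl

/-- The sum `∑ ωₙ tⁿ`. -/
noncomputable def powerValue (t : ℝ) (ω : BinString) : ℝ := ∑' n : ℕ, ((ω n : ℕ) : ℝ) * t ^ n

theorem digit_le_one (d : Fin 2) : ((d : ℕ) : ℝ) ≤ 1 := by
  rcases fin_two_cases d with rfl | rfl <;> simp

section Series

variable {t : ℝ} (h0 : 0 ≤ t) (h1 : t < 1)
include h0 h1

theorem summable_powerValue (ω : BinString) : Summable fun n : ℕ => ((ω n : ℕ) : ℝ) * t ^ n :=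
  Summable.of_nonneg_of_le (fun _ => by positivity)
    (fun n => mul_le_of_le_one_left (by positivity) (digit_le_one _))
    (summable_geometric_of_lt_one h0 h1)

theorem powerValue_eq (ω : BinString) :
    powerValue t ω = ((ω 0 : ℕ) : ℝ) + t * powerValue t (shift ω) := by
  unfold powerValue
  rw [(summable_powerValue h0 h1 ω).tsum_eq_zero_add, ← tsum_mul_left]
  simp only [pow_zero, mul_one, shift]
  congr 2
  ext n
  ring

omit h1 in
theorem powerValue_nonneg (ω : BinString) : 0 ≤ powerValue t ω :=
  tsum_nonneg fun _ => by positivity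

theorem powerValue_le (ω : BinString) : powerValue t ω ≤ (1 - t)⁻¹ := by
  rw [← tsum_geometric_of_lt_one h0 h1]
  exact (summable_powerValue h0 h1 ω).tsum_le_tsum
    (fun n => mul_le_of_le_one_left (by positivity) (digit_le_one _))
    (summable_geometric_of_lt_one h0 h1)

theorem powerValue_sub_eq {ω η : BinString} {n : ℕ} (h : ∀ i < n, ω i = η i) :
    powerValue t ω - powerValue t η
      = t ^ n * (powerValue t (shift^[n] ω) - powerValue t (shift^[n] η)) := by
  induction n generalizing ω η with
  | zero => simp
  | succ n ih =>
    rw [powerValue_eq h0 h1 ω, powerValue_eq h0 h1 η, h 0 n.succ_pos,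
      Function.iterate_succ_apply, Function.iterate_succ_apply, pow_succ', mul_assoc,
      ← ih (ω := shift ω) (η := shift η) (fun i hi => h (i + 1) (by omega))]
    ring

end Series

/-- The point of `[0,1]` with base `B` expansion `ω`, normalised so that `111⋯` stands for `1`. -/
noncomputable def expansion (B : ℝ) (ω : BinString) : ℝ := (1 - B⁻¹) * powerValue B⁻¹ ω

/-! ### Expansions and the shift -/

section Expansion

variable {B : ℝ} (hB : 1 < B)
include hB

/-- These are the branches of `stepMap`, but selected by the leading digit rather than by the
position relative to `p`. -/
theorem expansion_shift (ω : BinString) :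
    expansion B (shift ω) = if ω 0 = 0 then B * expansion B ω else B * expansion B ω + (1 - B) := by
  have hB0 : B ≠ 0 := by positivity
  unfold expansion
  rw [powerValue_eq (by positivity) (inv_lt_one_of_one_lt₀ hB) ω]
  rcases fin_two_cases (ω 0) with h | h <;> simp [h] <;> field_simp; ring

theorem expansion_mem (ω : BinString) : expansion B ω ∈ Set.Icc (0 : ℝ) 1 := by
  have h1 := inv_lt_one_of_one_lt₀ hB
  have h0 : (0 : ℝ) ≤ B⁻¹ := by positivity
  refine ⟨mul_nonneg (by linarith) (powerValue_nonneg h0 ω), ?_⟩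
  calc _ ≤ (1 - B⁻¹) * (1 - B⁻¹)⁻¹ :=
        mul_le_mul_of_nonneg_left (powerValue_le h0 h1 ω) (by linarith)
    _ = 1 := mul_inv_cancel₀ (by linarith)

theorem expansion_sub_eq {ω η : BinString} {n : ℕ} (h : ∀ i < n, ω i = η i) :
    B ^ n * (expansion B ω - expansion B η)
      = expansion B (shift^[n] ω) - expansion B (shift^[n] η) := by
  have hB0 : B ≠ 0 := by positivity
  unfold expansion
  rw [← mul_sub, powerValue_sub_eq (by positivity) (inv_lt_one_of_one_lt₀ hB) h, inv_pow]
  field_simp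

end Expansion

/-! ### Itineraries -/

section Itinerary

variable {B p : ℝ}

theorem digitOf_minus_eq_zero {x : ℝ} : digitOf p .minus x = 0 ↔ x ≤ p := by
  simp [digitOf]

theorem digitOf_plus_eq_zero {x : ℝ} : digitOf p .plus x = 0 ↔ x < p := by
  simp [digitOf]

theorem digitOf_minus_eq_one {x : ℝ} : digitOf p .minus x = 1 ↔ p < x := by
  simp [digitOf]

theorem digitOf_plus_eq_one {x : ℝ} : digitOf p .plus x = 1 ↔ p ≤ x := by
  simp [digitOf]

theorem le_of_digitOf_eq_zero {s : Side} {x : ℝ} (h : digitOf p s x = 0) : x ≤ p := by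
  cases s
  · exact digitOf_minus_eq_zero.1 h
  · exact (digitOf_plus_eq_zero.1 h).le

theorem le_of_digitOf_eq_one {s : Side} {x : ℝ} (h : digitOf p s x = 1) : p ≤ x := by
  cases s
  · exact (digitOf_minus_eq_one.1 h).le
  · exact digitOf_plus_eq_one.1 h

theorem digitOf_eq_zero_of_lt (s : Side) {x : ℝ} (h : x < p) : digitOf p s x = 0 := by
  cases s
  · exact digitOf_minus_eq_zero.2 h.le
  · exact digitOf_plus_eq_zero.2 h

theorem shift_itinerary (s : Side) (y : ℝ) :
    shift (itinerary B p s y) = itinerary B p s (stepMap B p s y) := rfl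

theorem shift_iterate_itinerary (s : Side) (n : ℕ) (y : ℝ) :
    shift^[n] (itinerary B p s y) = itinerary B p s ((stepMap B p s)^[n] y) := by
  induction n generalizing y with
  | zero => rfl
  | succ n ih => rw [Function.iterate_succ_apply, shift_itinerary, ih]; rfl

variable (hB : 1 < B)
include hB

theorem param_bounds (hp : p ∈ Set.Icc (1 - 1 / B) (1 / B)) :
    B - 1 ≤ B * p ∧ B * p ≤ 1 ∧ 0 < p ∧ p < 1 := by
  obtain ⟨h1, h2⟩ := hp
  have hB0 : 0 < B := by positivity
  have e : B * (1 / B) = 1 := mul_one_div_cancel hB0.ne'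
  have h3 : B * (1 - 1 / B) ≤ B * p := mul_le_mul_of_nonneg_left h1 hB0.le
  have h4 : B * p ≤ B * (1 / B) := mul_le_mul_of_nonneg_left h2 hB0.le
  have h5 : 1 / B < 1 := (div_lt_one hB0).2 hB
  refine ⟨by linarith, by linarith, by linarith, by linarith⟩

theorem stepMap_mem (hp : p ∈ Set.Icc (1 - 1 / B) (1 / B)) (s : Side) {y : ℝ}
    (hy : y ∈ Set.Icc (0 : ℝ) 1) : stepMap B p s y ∈ Set.Icc (0 : ℝ) 1 := by
  obtain ⟨h1, h2, -, -⟩ := param_bounds hB hp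
  have hB0 : 0 < B := by positivity
  obtain ⟨hy0, hy1⟩ := hy
  unfold stepMap
  rcases fin_two_cases (digitOf p s y) with h | h
  · have := mul_le_mul_of_nonneg_left (le_of_digitOf_eq_zero h) hB0.le
    rw [if_pos h]
    exact ⟨by positivity, by linarith⟩
  · have := mul_le_mul_of_nonneg_left (le_of_digitOf_eq_one h) hB0.le
    have := mul_le_mul_of_nonneg_left hy1 hB0.le
    rw [if_neg (by simp [h])]
    exact ⟨by linarith, by linarith⟩

theorem stepMap_iterate_mem (hp : p ∈ Set.Icc (1 - 1 / B) (1 / B)) (s : Side) (n : ℕ) {y : ℝ}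
    (hy : y ∈ Set.Icc (0 : ℝ) 1) : (stepMap B p s)^[n] y ∈ Set.Icc (0 : ℝ) 1 := by
  induction n generalizing y with
  | zero => exact hy
  | succ n ih => exact ih (stepMap_mem hB hp s hy)

theorem nonpos_of_le_inv_pow {a : ℝ} (C : ℝ)
    (h : ∀ n : ℕ, a ≤ C * B⁻¹ ^ n) : a ≤ 0 := by
  have := (tendsto_pow_atTop_nhds_zero_of_lt_one (r := B⁻¹) (by positivity)
    (inv_lt_one_of_one_lt₀ hB)).const_mul C
  rw [mul_zero] at this
  exact ge_of_tendsto' this h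

/-- One step multiplies the error by exactly `B`, yet the error never exceeds 1, both points being
in `[0,1]`. Hence it is at most `B⁻ⁿ` for every `n`. -/
theorem expansion_itinerary (hp : p ∈ Set.Icc (1 - 1 / B) (1 / B)) (s : Side) {y : ℝ}
    (hy : y ∈ Set.Icc (0 : ℝ) 1) : expansion B (itinerary B p s y) = y := by
  have hB0 : 0 < B := by positivity
  have key : ∀ n : ℕ, ∀ y ∈ Set.Icc (0 : ℝ) 1,
      |expansion B (itinerary B p s y) - y| ≤ 1 * B⁻¹ ^ n := by
    intro n
    induction n with
    | zero =>
      intro y hy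
      have := expansion_mem hB (itinerary B p s y)
      rw [pow_zero, mul_one, abs_le]
      exact ⟨by linarith [this.1, hy.2], by linarith [this.2, hy.1]⟩
    | succ n ih =>
      intro y hy
      have h := ih _ (stepMap_mem hB hp s hy)
      have e : expansion B (itinerary B p s (stepMap B p s y)) - stepMap B p s y
          = B * (expansion B (itinerary B p s y) - y) := by
        rw [← shift_itinerary, expansion_shift hB]
        change (if digitOf p s y = 0 then _ else _) - _ = _
        unfold stepMap
        split_ifs <;> ring
      rw [e, abs_mul, abs_of_pos hB0] at h
      rw [pow_succ]
      calc _ = (B * |expansion B (itinerary B p s y) - y|) * B⁻¹ := by field_simp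
        _ ≤ (1 * B⁻¹ ^ n) * B⁻¹ := mul_le_mul_of_nonneg_right h (by positivity)
        _ = _ := by ring
  have := nonpos_of_le_inv_pow hB 1 fun n => key n y hy
  exact sub_eq_zero.1 (abs_nonpos_iff.1 this)

theorem stepMap_iterate_sub_eq (hp : p ∈ Set.Icc (1 - 1 / B) (1 / B)) {s s' : Side} {x y : ℝ}
    (hx : x ∈ Set.Icc (0 : ℝ) 1) (hy : y ∈ Set.Icc (0 : ℝ) 1) {n : ℕ}
    (h : ∀ i < n, itinerary B p s x i = itinerary B p s' y i) :
    B ^ n * (x - y) = (stepMap B p s)^[n] x - (stepMap B p s')^[n] y := by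
  have := expansion_sub_eq hB h
  rwa [shift_iterate_itinerary, shift_iterate_itinerary, expansion_itinerary hB hp _ hx,
    expansion_itinerary hB hp _ hy,
    expansion_itinerary hB hp _ (stepMap_iterate_mem hB hp _ _ hx),
    expansion_itinerary hB hp _ (stepMap_iterate_mem hB hp _ _ hy)] at this

/-- While digits agree the gap `y - x` is stretched by `B`. At the first disagreement the positive
gap puts the orbit of `y` above that of `x`, so `y` must have the digit 1. Digits 0 and 1 mean `≤ p`
and `≥ p` for either sign, so the signs may differ. -/
theorem itinerary_lt (hp : p ∈ Set.Icc (1 - 1 / B) (1 / B)) (s s' : Side) {x y : ℝ}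
    (hx : x ∈ Set.Icc (0 : ℝ) 1) (hy : y ∈ Set.Icc (0 : ℝ) 1) (hxy : x < y) :
    toLex (itinerary B p s x) < toLex (itinerary B p s' y) := by
  rcases lt_trichotomy (toLex (itinerary B p s x)) (toLex (itinerary B p s' y)) with h | h | h
  · exact h
  · have := congrArg (expansion B) (toLex_inj.1 h)
    rw [expansion_itinerary hB hp _ hx, expansion_itinerary hB hp _ hy] at this
    exact absurd this hxy.ne
  · obtain ⟨n, h1, h2⟩ := toLex_lt_iff.1 h
    have h3 := stepMap_iterate_sub_eq hB hp hy hx h1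
    have h4 : 0 < B ^ n * (y - x) := mul_pos (by positivity) (by linarith)
    obtain ⟨h5, h6⟩ := eq_zero_one_of_lt h2
    have h7 := le_of_digitOf_eq_zero h5
    have h8 := le_of_digitOf_eq_one h6
    linarith

theorem param_mem (hp : p ∈ Set.Icc (1 - 1 / B) (1 / B)) : p ∈ Set.Icc (0 : ℝ) 1 := by
  obtain ⟨-, -, h1, h2⟩ := param_bounds hB hp
  exact ⟨h1.le, h2.le⟩

/-! ### The critical strings and admissibility -/

omit hB in
theorem critLeft_zero : critLeft B p 0 = 0 := digitOf_minus_eq_zero.2 le_rfl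

omit hB in
theorem critRight_zero : critRight B p 0 = 1 := digitOf_plus_eq_one.2 le_rfl

theorem critLeft_one (hp : p ∈ Set.Icc (1 - 1 / B) (1 / B)) : critLeft B p 1 = 1 := by
  obtain ⟨h1, h2, h3, h4⟩ := param_bounds hB hp
  refine digitOf_minus_eq_one.2 ?_
  change p < stepMap B p .minus p
  rw [stepMap, if_pos (digitOf_minus_eq_zero.2 le_rfl)]
  nlinarith

theorem critRight_one (hp : p ∈ Set.Icc (1 - 1 / B) (1 / B)) : critRight B p 1 = 0 := by
  obtain ⟨h1, h2, h3, h4⟩ := param_bounds hB hp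
  refine digitOf_plus_eq_zero.2 ?_
  change stepMap B p .plus p < p
  have : digitOf p .plus p = 1 := digitOf_plus_eq_one.2 le_rfl
  rw [stepMap, if_neg (by simp [this])]
  nlinarith

/-- For `y ≠ p` this is monotonicity. For `y = p` the itinerary is the endpoint that the half-open
gap of that sign leaves out. -/
theorem itinerary_notMem_gap (hp : p ∈ Set.Icc (1 - 1 / B) (1 / B)) (s : Side) {y : ℝ}
    (hy : y ∈ Set.Icc (0 : ℝ) 1) :
    itinerary B p s y ∉ gap (critLeft B p) (critRight B p) s := by
  have hp' := param_mem hB hp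
  cases s
  · rintro ⟨h1, h2⟩
    rcases lt_trichotomy y p with h | rfl | h
    · exact lt_asymm h1 (itinerary_lt hB hp .minus .minus hy hp' h)
    · exact lt_irrefl _ h1
    · exact h2.not_gt (itinerary_lt hB hp .plus .minus hp' hy h)
  · rintro ⟨h1, h2⟩
    rcases lt_trichotomy y p with h | rfl | h
    · exact h1.not_gt (itinerary_lt hB hp .plus .minus hy hp' h)
    · exact lt_irrefl _ h2
    · exact lt_asymm h2 (itinerary_lt hB hp .plus .plus hp' hy h)

theorem itinerary_mem_stringSpace (hp : p ∈ Set.Icc (1 - 1 / B) (1 / B)) (s : Side) {y : ℝ}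
    (hy : y ∈ Set.Icc (0 : ℝ) 1) :
    itinerary B p s y ∈ stringSpace (critLeft B p) (critRight B p) s := fun n => by
  rw [shift_iterate_itinerary]
  exact itinerary_notMem_gap hB hp s (stepMap_iterate_mem hB hp s n hy)

theorem admissible_crit (hp : p ∈ Set.Icc (1 - 1 / B) (1 / B)) :
    Admissible (critLeft B p) (critRight B p) where
  left_zero := critLeft_zero
  left_one := critLeft_one hB hp
  right_zero := critRight_zero
  right_one := critRight_one hB hp
  left_shift := itinerary_mem_stringSpace hB hp .minus (param_mem hB hp)
  right_shift := itinerary_mem_stringSpace hB hp .plus (param_mem hB hp)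

/-! ### Address spaces consist of itineraries -/

omit hB in
theorem shift_iterate_mem_stringSpace {α β : BinString} {s : Side} {ω : BinString}
    (h : ω ∈ stringSpace α β s) (n : ℕ) : shift^[n] ω ∈ stringSpace α β s := fun m => by
  rw [← Function.iterate_add_apply]
  exact h (m + n)

omit hB in
theorem lt_critRight_of_zero {ω : BinString} (h : ω 0 = 0) : toLex ω < toLex (critRight B p) :=
  toLex_lt_iff.2 ⟨0, by simp, by rw [h, critRight_zero]; decide⟩

omit hB in
theorem critLeft_lt_of_one {ω : BinString} (h : ω 0 = 1) : toLex (critLeft B p) < toLex ω :=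
  toLex_lt_iff.2 ⟨0, by simp, by rw [h, critLeft_zero]; decide⟩

omit hB in
theorem le_critLeft_of_zero {s : Side} {ω : BinString}
    (hω : ω ∉ gap (critLeft B p) (critRight B p) s) (h : ω 0 = 0) :
    toLex ω ≤ toLex (critLeft B p) := by
  have := lt_critRight_of_zero (B := B) (p := p) h
  by_contra! hc
  cases s
  · exact hω ⟨hc, this.le⟩
  · exact hω ⟨hc.le, this⟩

omit hB in
theorem critRight_le_of_one {s : Side} {ω : BinString}
    (hω : ω ∉ gap (critLeft B p) (critRight B p) s) (h : ω 0 = 1) :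
    toLex (critRight B p) ≤ toLex ω := by
  have := critLeft_lt_of_one (B := B) (p := p) h
  by_contra! hc
  cases s
  · exact hω ⟨this, hc.le⟩
  · exact hω ⟨this.le, hc⟩

theorem expansion_critLeft (hp : p ∈ Set.Icc (1 - 1 / B) (1 / B)) :
    expansion B (critLeft B p) = p := expansion_itinerary hB hp .minus (param_mem hB hp)

theorem expansion_critRight (hp : p ∈ Set.Icc (1 - 1 / B) (1 / B)) :
    expansion B (critRight B p) = p := expansion_itinerary hB hp .plus (param_mem hB hp)

/-- `n` is the first place of disagreement. There the critical string has digit 1, which for the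
sign `-` puts the critical orbit strictly above `p`; this gives the strict inequality. -/
theorem exists_of_lt_critLeft (hp : p ∈ Set.Icc (1 - 1 / B) (1 / B)) {ω : BinString}
    (h : toLex ω < toLex (critLeft B p)) : ∃ n : ℕ, n ≠ 0 ∧ shift^[n] ω 0 = 0 ∧
      B ^ n * (expansion B ω - p) < expansion B (shift^[n] ω) - p := by
  obtain ⟨n, h1, h2⟩ := toLex_lt_iff.1 h
  obtain ⟨h3, h4⟩ := eq_zero_one_of_lt h2
  have h5 := expansion_sub_eq hB h1
  rw [expansion_critLeft hB hp] at h5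
  rw [critLeft, shift_iterate_itinerary,
    expansion_itinerary hB hp _ (stepMap_iterate_mem hB hp _ _ (param_mem hB hp))] at h5
  have h6 := digitOf_minus_eq_one.1 h4
  refine ⟨n, ?_, ?_, by linarith⟩
  · rintro rfl
    rw [critLeft_zero] at h4
    exact absurd h4 (by decide)
  · rwa [shift_iterate_apply, zero_add]

theorem exists_of_critRight_lt (hp : p ∈ Set.Icc (1 - 1 / B) (1 / B)) {ω : BinString}
    (h : toLex (critRight B p) < toLex ω) : ∃ n : ℕ, n ≠ 0 ∧ shift^[n] ω 0 = 1 ∧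
      B ^ n * (p - expansion B ω) < p - expansion B (shift^[n] ω) := by
  obtain ⟨n, h1, h2⟩ := toLex_lt_iff.1 h
  obtain ⟨h3, h4⟩ := eq_zero_one_of_lt h2
  have h5 := expansion_sub_eq hB h1
  rw [expansion_critRight hB hp] at h5
  rw [critRight, shift_iterate_itinerary,
    expansion_itinerary hB hp _ (stepMap_iterate_mem hB hp _ _ (param_mem hB hp))] at h5
  have h6 := digitOf_plus_eq_zero.1 h3
  refine ⟨n, ?_, ?_, by linarith⟩
  · rintro rfl
    rw [critRight_zero] at h3
    exact absurd h3 (by decide)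
  · rwa [shift_iterate_apply, zero_add]

theorem le_inv_pow_succ {n k : ℕ} (hn : n ≠ 0) {a b : ℝ} (h : B ^ n * a ≤ b)
    (hb : b ≤ 1 * B⁻¹ ^ k) : a ≤ 1 * B⁻¹ ^ (k + 1) := by
  have hB0 : 0 < B := by positivity
  rcases le_or_gt a 0 with ha | ha
  · exact ha.trans (by positivity)
  have h1 : B ≤ B ^ n := le_self_pow₀ hB.le hn
  have h2 : B * a ≤ 1 * B⁻¹ ^ k := (mul_le_mul_of_nonneg_right h1 ha.le).trans (h.trans hb)
  calc a = (B * a) * B⁻¹ := by field_simp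
    _ ≤ (1 * B⁻¹ ^ k) * B⁻¹ := mul_le_mul_of_nonneg_right h2 (by positivity)
    _ = _ := by ring

/-- Bootstrapping: the excess of a string with leading 0 over `p` is at most 1. When the string
leaves the critical one, the excess has grown by at least `B` and is bounded by the excess of
another string with leading 0. Each pass thus improves the bound by `B⁻¹`. Leading digit 1 is
symmetric. -/
theorem expansion_le_of_zero_and_ge_of_one (hp : p ∈ Set.Icc (1 - 1 / B) (1 / B)) {s : Side}
    {ω : BinString} (hω : ω ∈ stringSpace (critLeft B p) (critRight B p) s) :
    (ω 0 = 0 → expansion B ω ≤ p) ∧ (ω 0 = 1 → p ≤ expansion B ω) := by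
  have hp' := param_mem hB hp
  have key : ∀ k : ℕ, ∀ ω ∈ stringSpace (critLeft B p) (critRight B p) s,
      (ω 0 = 0 → expansion B ω - p ≤ 1 * B⁻¹ ^ k) ∧
      (ω 0 = 1 → p - expansion B ω ≤ 1 * B⁻¹ ^ k) := by
    intro k
    induction k with
    | zero =>
      intro ω _
      have := expansion_mem hB ω
      rw [pow_zero, mul_one]
      exact ⟨fun _ => by linarith [this.2, hp'.1], fun _ => by linarith [this.1, hp'.2]⟩
    | succ k ih =>
      intro ω hω
      constructor
      · intro h
        rcases (le_critLeft_of_zero (hω 0) h).lt_or_eq with hlt | heq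
        · obtain ⟨n, h1, h2, h3⟩ := exists_of_lt_critLeft hB hp hlt
          exact le_inv_pow_succ hB h1 h3.le ((ih _ (shift_iterate_mem_stringSpace hω n)).1 h2)
        · have : expansion B ω = p := by
            rw [show ω = critLeft B p from toLex_inj.1 heq, expansion_critLeft hB hp]
          rw [this, sub_self]
          positivity
      · intro h
        rcases (critRight_le_of_one (hω 0) h).lt_or_eq with hlt | heq
        · obtain ⟨n, h1, h2, h3⟩ := exists_of_critRight_lt hB hp hlt
          exact le_inv_pow_succ hB h1 h3.le ((ih _ (shift_iterate_mem_stringSpace hω n)).2 h2)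
        · have : expansion B ω = p := by
            rw [show ω = critRight B p from (toLex_inj.1 heq).symm, expansion_critRight hB hp]
          rw [this, sub_self]
          positivity
  exact ⟨fun h => sub_nonpos.1 (nonpos_of_le_inv_pow hB 1 fun k => (key k ω hω).1 h),
    fun h => sub_nonpos.1 (nonpos_of_le_inv_pow hB 1 fun k => (key k ω hω).2 h)⟩

theorem expansion_lt_of_lt_critLeft (hp : p ∈ Set.Icc (1 - 1 / B) (1 / B)) {s : Side}
    {ω : BinString} (hω : ω ∈ stringSpace (critLeft B p) (critRight B p) s)
    (h : toLex ω < toLex (critLeft B p)) : expansion B ω < p := by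
  obtain ⟨n, -, h2, h3⟩ := exists_of_lt_critLeft hB hp h
  have h4 := (expansion_le_of_zero_and_ge_of_one hB hp (shift_iterate_mem_stringSpace hω n)).1 h2
  have : B ^ n * (expansion B ω - p) < 0 := by linarith
  linarith [neg_of_mul_neg_right this (by positivity)]

theorem lt_expansion_of_critRight_lt (hp : p ∈ Set.Icc (1 - 1 / B) (1 / B)) {s : Side}
    {ω : BinString} (hω : ω ∈ stringSpace (critLeft B p) (critRight B p) s)
    (h : toLex (critRight B p) < toLex ω) : p < expansion B ω := by
  obtain ⟨n, -, h2, h3⟩ := exists_of_critRight_lt hB hp h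
  have h4 := (expansion_le_of_zero_and_ge_of_one hB hp (shift_iterate_mem_stringSpace hω n)).2 h2
  have : B ^ n * (p - expansion B ω) < 0 := by linarith
  linarith [neg_of_mul_neg_right this (by positivity)]

theorem digitOf_expansion (hp : p ∈ Set.Icc (1 - 1 / B) (1 / B)) {s : Side}
    {ω : BinString} (hω : ω ∈ stringSpace (critLeft B p) (critRight B p) s) :
    digitOf p s (expansion B ω) = ω 0 := by
  obtain ⟨h1, h2⟩ := expansion_le_of_zero_and_ge_of_one hB hp hω
  rcases fin_two_cases (ω 0) with h | h
  · rw [h]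
    cases s
    · exact digitOf_minus_eq_zero.2 (h1 h)
    · refine digitOf_plus_eq_zero.2 (expansion_lt_of_lt_critLeft hB hp hω ?_)
      refine lt_of_not_ge fun hc => ?_
      -- For the sign `+` the critical left string itself lies in the gap, so the comparison with it
      -- is strict.
      exact hω 0 ⟨hc, lt_critRight_of_zero h⟩
  · rw [h]
    cases s
    · refine digitOf_minus_eq_one.2 (lt_expansion_of_critRight_lt hB hp hω ?_)
      refine lt_of_not_ge fun hc => ?_
      exact hω 0 ⟨critLeft_lt_of_one h, hc⟩
    · exact digitOf_plus_eq_one.2 (h2 h)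

theorem stepMap_iterate_expansion (hp : p ∈ Set.Icc (1 - 1 / B) (1 / B)) {s : Side}
    {ω : BinString} (hω : ω ∈ stringSpace (critLeft B p) (critRight B p) s) (n : ℕ) :
    (stepMap B p s)^[n] (expansion B ω) = expansion B (shift^[n] ω) := by
  induction n with
  | zero => rfl
  | succ n ih =>
    rw [Function.iterate_succ_apply', Function.iterate_succ_apply', ih, expansion_shift hB, stepMap,
      digitOf_expansion hB hp (shift_iterate_mem_stringSpace hω n)]

theorem itinerary_expansion (hp : p ∈ Set.Icc (1 - 1 / B) (1 / B)) {s : Side}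
    {ω : BinString} (hω : ω ∈ stringSpace (critLeft B p) (critRight B p) s) :
    itinerary B p s (expansion B ω) = ω := by
  ext n : 1
  rw [itinerary, stepMap_iterate_expansion hB hp hω,
    digitOf_expansion hB hp (shift_iterate_mem_stringSpace hω n), shift_iterate_apply, zero_add]

end Itinerary

/-! ### The growth rate -/

section Growth

variable {B p : ℝ} (hB : 1 < B)
include hB

/-- Points whose itineraries share an `n`-word lie in one interval of length `B⁻ⁿ`. These intervals
cover `[0,1]`, and comparing measures bounds their number. -/
theorem pow_le_wordCount (hp : p ∈ Set.Icc (1 - 1 / B) (1 / B)) {Γ : Set BinString}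
    (hΓ : stringSpace (critLeft B p) (critRight B p) .minus ⊆ Γ) (n : ℕ) :
    B ^ n ≤ wordCount Γ n := by
  have hB0 : 0 < B := by positivity
  set r : BinString → Fin n → Fin 2 := fun ω i => ω i
  have hfin : (r '' Γ).Finite := Set.toFinite _
  -- The word padded with zeros expands to the left end of its interval.
  let Z : (Fin n → Fin 2) → BinString := fun w k => if h : k < n then w ⟨k, h⟩ else 0
  have hcover : Set.Icc (0 : ℝ) 1 ⊆ ⋃ w ∈ hfin.toFinset,
      Set.Icc (expansion B (Z w)) (expansion B (Z w) + (B ^ n)⁻¹) := by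
    intro y hy
    set ω := itinerary B p .minus y with hω
    refine Set.mem_biUnion (x := r ω) ?_ ?_
    · rw [Finset.mem_coe, Set.Finite.mem_toFinset]
      exact ⟨ω, hΓ (itinerary_mem_stringSpace hB hp _ hy), rfl⟩
    · have h1 : ∀ i < n, ω i = Z (r ω) i := fun i hi => by simp [Z, r, hi]
      have h2 := expansion_sub_eq hB h1
      have h3 : shift^[n] (Z (r ω)) = fun _ => 0 := by
        ext k : 1
        simp [shift_iterate_apply, Z]
      have h4 : expansion B (fun _ => 0) = 0 := by simp [expansion, powerValue]
      rw [h3, h4, sub_zero, hω, expansion_itinerary hB hp _ hy, ← hω] at h2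
      have h5 := expansion_mem hB (shift^[n] ω)
      rw [← h2] at h5
      have hBn : 0 < B ^ n := by positivity
      constructor
      · linarith [nonneg_of_mul_nonneg_right h5.1 hBn]
      · have h6 := (le_div_iff₀' hBn).2 h5.2
        rw [one_div] at h6
        linarith
  have h := (MeasureTheory.measure_mono (μ := MeasureTheory.volume) hcover).trans
    (MeasureTheory.measure_biUnion_finset_le _ _)
  simp only [Real.volume_Icc, add_sub_cancel_left, sub_zero, ENNReal.ofReal_one, Finset.sum_const,
    nsmul_eq_mul] at h
  rw [wordCount, Set.ncard_eq_toFinset_card _ hfin]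
  rw [← ENNReal.ofReal_natCast, ← ENNReal.ofReal_mul (by positivity), ← ENNReal.ofReal_one,
    ENNReal.ofReal_le_ofReal_iff (by positivity), ← div_eq_mul_inv,
    le_div_iff₀ (by positivity), one_mul] at h
  exact h

omit hB in
theorem wordCount_le (Γ : Set BinString) (n : ℕ) : wordCount Γ n ≤ 2 ^ n := by
  refine (Set.ncard_le_card _).trans ?_
  simp

theorem not_isNull_crit (hp : p ∈ Set.Icc (1 - 1 / B) (1 / B)) :
    ¬ IsNull (critLeft B p) (critRight B p) := by
  intro h
  rw [IsNull, growthRate] at h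
  set Γ := stringSpace (critLeft B p) (critRight B p) .minus ∪
    stringSpace (critLeft B p) (critRight B p) .plus
  have hlog : 0 < Real.log B := Real.log_pos hB
  have hpow := pow_le_wordCount hB hp (Γ := Γ) Set.subset_union_left
  have hlow : ∀ᶠ n : ℕ in Filter.atTop,
      Real.log B ≤ 1 / (n : ℝ) * Real.log (wordCount Γ n) := by
    filter_upwards [Filter.eventually_gt_atTop 0] with n hn
    have hn' : (0 : ℝ) < n := by exact_mod_cast hn
    rw [one_div, ← div_eq_inv_mul, le_div_iff₀' hn', ← Real.log_pow]
    exact Real.log_le_log (by positivity) (hpow n)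
  -- A real `limsup` obeys the lower bound only if the sequence is bounded above.
  have hup : ∀ᶠ n : ℕ in Filter.atTop,
      1 / (n : ℝ) * Real.log (wordCount Γ n) ≤ Real.log 2 := by
    filter_upwards [Filter.eventually_gt_atTop 0] with n hn
    have hn' : (0 : ℝ) < n := by exact_mod_cast hn
    rw [one_div, ← div_eq_inv_mul, div_le_iff₀' hn', ← Real.log_pow]
    exact Real.log_le_log (lt_of_lt_of_le (by positivity) (hpow n))
      (by exact_mod_cast wordCount_le Γ n)
  have := Filter.le_limsup_of_frequently_le hlow.frequently ⟨_, hup⟩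
  linarith

/-! ### The least solution -/

/-- If the critical strings have the same value at `t`, then an estimate for the variation of the
values of itineraries near `p` improves at the time when an itinerary leaves the critical one. -/
theorem exists_powerValue_dist_le {t M ε : ℝ} (hp : p ∈ Set.Icc (1 - 1 / B) (1 / B)) (h0 : 0 ≤ t)
    (h1 : t < 1) (hK : powerValue t (critLeft B p) = powerValue t (critRight B p))
    (H : ∀ s : Side, ∀ z ∈ Set.Icc (0 : ℝ) 1,
      |powerValue t (itinerary B p s z) - powerValue t (critLeft B p)| ≤ M * |z - p| + ε)
    (s : Side) {z : ℝ} (hz : z ∈ Set.Icc (0 : ℝ) 1) (hzp : z ≠ p) :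
    ∃ (n : ℕ) (s' : Side), n ≠ 0 ∧ 0 < |(stepMap B p s')^[n] p - p| ∧
      |(stepMap B p s')^[n] p - p| ≤ B ^ n * |z - p| ∧
      |powerValue t (itinerary B p s z) - powerValue t (critLeft B p)|
        ≤ (t * B) ^ n * M * |z - p| + 2 * t ^ n * ε := by
  have hp' := param_mem hB hp
  -- At the first disagreement the orbits lie on opposite sides of `p`, so their distances to `p`
  -- add up to `B ^ n * (y - x)`. Applying `H` to both therefore uses `M` once and `ε` twice.
  have main : ∀ {s s' : Side} {x y : ℝ}, x ∈ Set.Icc (0 : ℝ) 1 → y ∈ Set.Icc (0 : ℝ) 1 → x < y →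
      ∃ n : ℕ, itinerary B p s x n = 0 ∧ itinerary B p s' y n = 1 ∧
        (stepMap B p s)^[n] x ≤ p ∧ p ≤ (stepMap B p s')^[n] y ∧
        B ^ n * (x - y) = (stepMap B p s)^[n] x - (stepMap B p s')^[n] y ∧
        |powerValue t (itinerary B p s x) - powerValue t (itinerary B p s' y)|
          ≤ (t * B) ^ n * M * (y - x) + 2 * t ^ n * ε := by
    intro s s' x y hx hy hxy
    obtain ⟨n, h2, h3⟩ := toLex_lt_iff.1 (itinerary_lt hB hp s s' hx hy hxy)
    obtain ⟨h4, h5⟩ := eq_zero_one_of_lt h3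
    have h6 := le_of_digitOf_eq_zero h4
    have h7 := le_of_digitOf_eq_one h5
    have h8 := stepMap_iterate_sub_eq hB hp hx hy h2
    refine ⟨n, h4, h5, h6, h7, h8, ?_⟩
    rw [powerValue_sub_eq h0 h1 h2, shift_iterate_itinerary, shift_iterate_itinerary, abs_mul,
      abs_of_nonneg (by positivity)]
    have h9 := H s _ (stepMap_iterate_mem hB hp s n hx)
    have h10 := H s' _ (stepMap_iterate_mem hB hp s' n hy)
    rw [abs_of_nonpos (sub_nonpos.2 h6)] at h9
    rw [abs_of_nonneg (sub_nonneg.2 h7), abs_sub_comm] at h10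
    have h11 := abs_sub_le (powerValue t (itinerary B p s ((stepMap B p s)^[n] x)))
      (powerValue t (critLeft B p)) (powerValue t (itinerary B p s' ((stepMap B p s')^[n] y)))
    have h12 : M * (B ^ n * (y - x))
        = M * ((stepMap B p s')^[n] y - (stepMap B p s)^[n] x) := by
      rw [show B ^ n * (y - x) = -(B ^ n * (x - y)) by ring, h8]; ring
    calc _ ≤ t ^ n * (M * (B ^ n * (y - x)) + 2 * ε) :=
          mul_le_mul_of_nonneg_left (by linarith) (by positivity)
      _ = _ := by rw [mul_pow]; ring
  -- On each side of `p` the critical string is chosen so that the separating digit keeps its orbit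
  -- strictly away from `p`; this also forces `n ≠ 0`.
  rcases lt_or_gt_of_ne hzp with hlt | hgt
  · obtain ⟨n, h4, h5, h6, h7, h8, h9⟩ := main (s := s) (s' := .minus) hz hp' hlt
    have h10 := digitOf_minus_eq_one.1 h5
    refine ⟨n, .minus, ?_, abs_pos.2 (by linarith), ?_, ?_⟩
    · rintro rfl
      exact lt_irrefl _ h10
    · rw [abs_of_pos (sub_pos.2 h10), abs_of_neg (sub_neg.2 hlt), mul_neg, h8]
      linarith
    · rw [abs_of_neg (sub_neg.2 hlt), neg_sub]
      exact h9
  · obtain ⟨n, h4, h5, h6, h7, h8, h9⟩ := main (s := .plus) (s' := s) hp' hz hgt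
    have h10 := digitOf_plus_eq_zero.1 h4
    refine ⟨n, .plus, ?_, abs_pos.2 (by linarith), ?_, ?_⟩
    · rintro rfl
      exact lt_irrefl _ h10
    · rw [abs_of_neg (sub_neg.2 h10), abs_of_pos (sub_pos.2 hgt), ← neg_sub p z, mul_neg, h8]
      linarith
    · rw [abs_of_pos (sub_pos.2 hgt), hK, abs_sub_comm]
      exact h9

/-- Start from the trivial bound `C` as error term. Late separation halves the error without
increasing `M`; early separation keeps `z` a definite distance from `p`, where `M * |z - p|` already
exceeds `C`. -/
theorem exists_powerValue_lipschitz {t : ℝ} (hp : p ∈ Set.Icc (1 - 1 / B) (1 / B)) (h0 : 0 ≤ t)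
    (h1 : t < 1) (htB : t * B ≤ 1)
    (hK : powerValue t (critLeft B p) = powerValue t (critRight B p)) :
    ∃ M : ℝ, 0 ≤ M ∧ ∀ s : Side, ∀ z ∈ Set.Icc (0 : ℝ) 1,
      |powerValue t (itinerary B p s z) - powerValue t (critLeft B p)| ≤ M * |z - p| := by
  have hB0 : 0 < B := by positivity
  set C := (1 - t)⁻¹
  have hC : 0 ≤ C := inv_nonneg.2 (by linarith)
  have hbound : ∀ ω η : BinString, |powerValue t ω - powerValue t η| ≤ C := fun ω η => by
    have := powerValue_le h0 h1 ω
    have := powerValue_le h0 h1 η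
    have := powerValue_nonneg h0 ω
    have := powerValue_nonneg h0 η
    rw [abs_le]
    constructor <;> linarith
  -- For `n ≥ m` this gives `2 * t ^ n ≤ 1 / 2`.
  obtain ⟨m, hm⟩ := exists_pow_lt_of_lt_one (show (0 : ℝ) < 1 / 4 by norm_num) h1
  -- Separation at time `n` forces `|z - p|` to be at least `|f^n(p) - p| / B ^ n`, so `g s n` is a
  -- sufficient slope. A zero denominator yields 0 and does no harm: only times with positive
  -- distance are used.
  let g : Side → ℕ → ℝ := fun s n => C * B ^ n / |(stepMap B p s)^[n] p - p|
  have hg : ∀ s n, 0 ≤ g s n := fun s n => by positivity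
  let M := ∑ n ∈ Finset.range m, (g .minus n + g .plus n)
  have hM : 0 ≤ M := Finset.sum_nonneg fun n _ => add_nonneg (hg _ _) (hg _ _)
  have hgM : ∀ s, ∀ n < m, g s n ≤ M := fun s n hn => by
    refine le_trans ?_ (Finset.single_le_sum (f := fun n => g .minus n + g .plus n)
      (fun n _ => add_nonneg (hg _ _) (hg _ _)) (Finset.mem_range.2 hn))
    cases s
    · exact le_add_of_nonneg_right (hg _ _)
    · exact le_add_of_nonneg_left (hg _ _)
  have hp0 : ∀ s, powerValue t (itinerary B p s p) = powerValue t (critLeft B p) := fun s => by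
    cases s
    · rfl
    · exact hK.symm
  have key : ∀ k : ℕ, ∀ s : Side, ∀ z ∈ Set.Icc (0 : ℝ) 1,
      |powerValue t (itinerary B p s z) - powerValue t (critLeft B p)|
        ≤ M * |z - p| + C * 2⁻¹ ^ k := by
    intro k
    induction k with
    | zero =>
      intro s z hz
      rw [pow_zero, mul_one]
      exact (hbound _ _).trans (le_add_of_nonneg_left (by positivity))
    | succ k ih =>
      intro s z hz
      rcases eq_or_ne z p with rfl | hzp
      · rw [hp0, sub_self, abs_zero]
        positivity
      obtain ⟨n, s', h2, h3, h4, h5⟩ := exists_powerValue_dist_le hB hp h0 h1 hK ih s hz hzp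
      rcases lt_or_ge n m with hn | hn
      · have h6 := (div_le_iff₀ h3).1 (hgM s' n hn)
        have h7 : C * B ^ n ≤ M * |z - p| * B ^ n := by
          refine h6.trans ((mul_le_mul_of_nonneg_left h4 hM).trans_eq (by ring))
        have h8 := le_of_mul_le_mul_right h7 (by positivity)
        exact (hbound _ _).trans (h8.trans (le_add_of_nonneg_right (by positivity)))
      · refine h5.trans (add_le_add ?_ ?_)
        · exact mul_le_mul_of_nonneg_right
            (mul_le_of_le_one_left hM (pow_le_one₀ (by positivity) htB)) (abs_nonneg _)
        · have h6 : 2 * t ^ n ≤ 2⁻¹ := by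
            have := pow_le_pow_of_le_one h0 h1.le hn
            linarith
          calc _ ≤ 2⁻¹ * (C * 2⁻¹ ^ k) := mul_le_mul_of_nonneg_right h6 (by positivity)
            _ = _ := by ring
  refine ⟨M, hM, fun s z hz => sub_nonpos.1 ?_⟩
  exact nonpos_of_le_inv_pow one_lt_two C fun k => by linarith [key k s z hz]

theorem powerValue_crit_ne {t : ℝ} (hp : p ∈ Set.Icc (1 - 1 / B) (1 / B)) (h0 : 0 < t)
    (htB : t * B < 1) : powerValue t (critLeft B p) ≠ powerValue t (critRight B p) := by
  intro hK
  have hB0 : 0 < B := by positivity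
  have h1 : t < 1 := by nlinarith
  obtain ⟨M, hM, hL⟩ := exists_powerValue_lipschitz hB hp h0.le h1 htB.le hK
  have key : ∀ k : ℕ, ∀ s : Side, ∀ z ∈ Set.Icc (0 : ℝ) 1,
      |powerValue t (itinerary B p s z) - powerValue t (critLeft B p)|
        ≤ (t * B) ^ k * M * |z - p| + 0 := by
    intro k
    induction k with
    | zero => simpa using hL
    | succ k ih =>
      intro s z hz
      rcases eq_or_ne z p with rfl | hzp
      · simpa using hL s z hz
      obtain ⟨n, s', h2, h3, h4, h5⟩ := exists_powerValue_dist_le hB hp h0.le h1 hK ih s hz hzp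
      have h6 : (t * B) ^ n ≤ t * B := pow_le_of_le_one (by positivity) htB.le h2
      rw [mul_zero] at h5
      refine h5.trans (add_le_add ?_ le_rfl)
      refine mul_le_mul_of_nonneg_right ?_ (abs_nonneg _)
      rw [pow_succ', mul_assoc]
      exact mul_le_mul_of_nonneg_right h6 (by positivity)
  -- The fixed point `0` lies at a positive distance from `p`, but its value must agree with that of
  -- the critical string.
  have hz : itinerary B p .minus 0 = fun _ => 0 := by
    obtain ⟨-, -, hp0, -⟩ := param_bounds hB hp
    have h2 : digitOf p .minus 0 = 0 := digitOf_minus_eq_zero.2 hp0.le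
    have h3 : ∀ n, (stepMap B p .minus)^[n] 0 = 0 :=
      Function.iterate_fixed (by rw [stepMap, if_pos h2, mul_zero])
    ext n : 1
    rw [itinerary, h3, h2]
  have h2 : t ≤ powerValue t (critLeft B p) := by
    rw [powerValue_eq h0.le h1, powerValue_eq h0.le h1 (shift _)]
    have h3 : shift (critLeft B p) 0 = 1 := critLeft_one hB hp
    have h4 := powerValue_nonneg h0.le (shift (shift (critLeft B p)))
    rw [critLeft_zero, h3]
    simp only [Fin.val_zero, Fin.val_one, Nat.cast_zero, Nat.cast_one, zero_add]
    exact le_mul_of_one_le_right h0.le (le_add_of_nonneg_right (by positivity))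
  have h3 := nonpos_of_le_inv_pow (B := (t * B)⁻¹) ((one_lt_inv₀ (by positivity)).2 htB)
    (M * |0 - p|) fun k => (key k .minus 0 ⟨le_rfl, zero_le_one⟩).trans_eq (by rw [inv_inv]; ring)
  rw [hz, show powerValue t (fun _ => 0) = 0 by simp [powerValue], zero_sub, abs_neg] at h3
  linarith [le_abs_self (powerValue t (critLeft B p))]

theorem isLeast_solutions (hB₂ : B < 2) (hp : p ∈ Set.Icc (1 - 1 / B) (1 / B)) :
    IsLeast (solutions (critLeft B p) (critRight B p)) (1 / B) := by
  have hB0 : 0 < B := by positivity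
  refine ⟨⟨⟨one_div_le_one_div_of_le hB0 hB₂.le, (div_lt_one hB0).2 hB⟩, ?_⟩, ?_⟩
  · have h := (expansion_critLeft hB hp).trans (expansion_critRight hB hp).symm
    rw [one_div]
    exact mul_left_cancel₀ (sub_ne_zero.2 (inv_lt_one_of_one_lt₀ hB).ne') h
  · rintro x ⟨⟨hx1, hx2⟩, hx⟩
    by_contra! hc
    exact powerValue_crit_ne hB hp (by linarith) ((lt_div_iff₀ hB0).1 hc) hx

theorem pairBase_crit (hB₂ : B < 2) (hp : p ∈ Set.Icc (1 - 1 / B) (1 / B)) :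
    pairBase (critLeft B p) (critRight B p) = B := by
  rw [pairBase, (isLeast_solutions hB hB₂ hp).csInf_eq, one_div_one_div]

end Growth

/-! ### Decimals and their strings -/

/-- The string of the digits of a decimal in the places `k - 1, k - 2, …`. -/
def Decimal.digitsBelow (σ : Decimal) (k : ℤ) : BinString := fun j => σ.digit (k - 1 - j)

theorem digitsBelow_place (ω : BinString) (k : ℤ) : (place ω k).digitsBelow k = ω := by
  ext j : 1
  have h : k - 1 - (j : ℤ) < k := by omega
  have h' : (k - 1 - (k - 1 - (j : ℤ))).toNat = j := by omega
  simp only [Decimal.digitsBelow, place, if_pos h, h']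

theorem shift_digitsBelow (σ : Decimal) (k : ℤ) :
    shift (σ.digitsBelow (k + 1)) = σ.digitsBelow k := by
  ext j : 1
  simp only [Decimal.digitsBelow, shift]
  congr 1
  push_cast
  ring

theorem shift_iterate_digitsBelow (σ : Decimal) (k : ℤ) (n : ℕ) :
    shift^[n] (σ.digitsBelow (k + n)) = σ.digitsBelow k := by
  induction n with
  | zero => simp
  | succ n ih =>
    rw [Function.iterate_succ_apply, Nat.cast_succ, ← add_assoc, shift_digitsBelow, ih]

theorem digitsBelow_succ {σ : Decimal} {k : ℤ} (h : σ.digit k = 0) :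
    σ.digitsBelow (k + 1) = consZero (σ.digitsBelow k) := by
  ext j : 1
  cases j with
  | zero => simpa [Decimal.digitsBelow, consZero] using h
  | succ j => exact congrFun (shift_digitsBelow σ k) j

theorem place_digitsBelow {σ : Decimal} {k : ℤ} (h : ∀ n, k ≤ n → σ.digit n = 0) :
    place (σ.digitsBelow k) k = σ := by
  ext n : 2
  simp only [place, Decimal.digitsBelow]
  split_ifs with hn
  · congr 1
    omega
  · exact (h n (not_lt.1 hn)).symm

theorem place_digit_of_le (ω : BinString) {k n : ℤ} (h : k ≤ n) : (place ω k).digit n = 0 :=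
  if_neg (not_lt.2 h)

theorem Decimal.exists_digit_eq_zero (σ : Decimal) :
    ∃ K : ℤ, ∀ k, K ≤ k → ∀ n, k ≤ n → σ.digit n = 0 := by
  obtain ⟨N, hN⟩ := σ.eventually_zero
  exact ⟨N + 1, fun k hk n hn => hN n (by omega)⟩

theorem shift_consZero (ω : BinString) : shift (consZero ω) = ω := rfl

/-- Reindex the places below `k` by `j = k - 1 - n`; the factor is `B ^ (k - 1)` divided by the
normalisation `1 - B⁻¹`. -/
theorem hasSum_digits {B : ℝ} (hB : 1 < B) {σ : Decimal} {k : ℤ}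
    (h : ∀ n, k ≤ n → σ.digit n = 0) :
    HasSum (fun n : ℤ => ((σ.digit n : ℕ) : ℝ) * B ^ n)
      (B ^ k / (B - 1) * expansion B (σ.digitsBelow k)) := by
  have hB0 : B ≠ 0 := by positivity
  have hB1 : B - 1 ≠ 0 := by linarith
  have hi : Function.Injective fun j : ℕ => k - 1 - (j : ℤ) := fun a b hab => by
    simpa using hab
  rw [← hi.hasSum_iff]
  · have := ((summable_powerValue (t := B⁻¹) (by positivity) (inv_lt_one_of_one_lt₀ hB)
      (σ.digitsBelow k)).hasSum).mul_left (B ^ (k - 1))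
    have e : B ^ k / (B - 1) * expansion B (σ.digitsBelow k)
        = B ^ (k - 1) * ∑' j : ℕ, ((σ.digitsBelow k j : ℕ) : ℝ) * B⁻¹ ^ j := by
      unfold expansion powerValue
      rw [zpow_sub_one₀ hB0]
      field_simp
    rw [e]
    refine this.congr_fun fun j => ?_
    rw [Function.comp_apply, zpow_sub₀ hB0, inv_pow, zpow_natCast]
    simp only [Decimal.digitsBelow]
    ring
  · intro n hn
    have : k ≤ n := by
      by_contra! hc
      exact hn ⟨(k - 1 - n).toNat, by simp only []; omega⟩
    simp [h n this]

/-! ### The radix systems of critical pairs -/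

section Systems

variable {B p : ℝ}

/-- Since `0ω` is below the right critical string, the extra condition says exactly that `0ω` avoids
the gap. -/
theorem mem_stringSpaceZero_iff {s : Side} {ω : BinString} :
    ω ∈ stringSpaceZero (critLeft B p) (critRight B p) s ↔
      consZero ω ∈ stringSpace (critLeft B p) (critRight B p) s := by
  have hlt : toLex (consZero ω) < toLex (critRight B p) := lt_critRight_of_zero rfl
  constructor
  · intro h n
    cases n with
    | zero =>
      cases s
      · exact fun hg => hg.1.not_ge h.2
      · exact fun hg => hg.1.not_gt h.2
    | succ n =>
      rw [Function.iterate_succ_apply, shift_consZero]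
      cases s
      · exact h.1 n
      · exact h.1 n
  · intro h
    have h1 := shift_iterate_mem_stringSpace h 1
    cases s
    · exact ⟨h1, le_critLeft_of_zero (h 0) rfl⟩
    · exact ⟨h1, lt_of_not_ge fun hc => h 0 ⟨hc, hlt⟩⟩

variable (hB : 1 < B)
include hB

theorem consZero_mem_of_zero (hp : p ∈ Set.Icc (1 - 1 / B) (1 / B)) {s : Side} {ω : BinString}
    (hω : ω ∈ stringSpace (critLeft B p) (critRight B p) s) (h : ω 0 = 0) :
    consZero ω ∈ stringSpace (critLeft B p) (critRight B p) s := by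
  have hlt : toLex (consZero ω) < toLex (critLeft B p) := by
    refine toLex_lt_iff.2 ⟨1, fun i hi => ?_, ?_⟩
    · obtain rfl : i = 0 := by omega
      rw [critLeft_zero]
      rfl
    · rw [critLeft_one hB hp, show consZero ω 1 = 0 from h]
      decide
  rw [← mem_stringSpaceZero_iff]
  cases s
  · exact ⟨hω, hlt.le⟩
  · exact ⟨hω, hlt⟩

/-- This description does not depend on how the decimal is written. Lower places arise by shifting,
higher ones by padding; the first zero is covered by the definition, and further zeros give strings
`00⋯`, which lie below `01⋯`. -/
theorem mem_decimalSpace_iff (hp : p ∈ Set.Icc (1 - 1 / B) (1 / B)) {s : Side} {σ : Decimal} :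
    σ ∈ decimalSpace (critLeft B p) (critRight B p) s ↔
      ∀ k, σ.digitsBelow k ∈ stringSpace (critLeft B p) (critRight B p) s := by
  constructor
  · rintro ⟨ω, hω, k, rfl⟩ k'
    rw [mem_stringSpaceZero_iff] at hω
    have h0 : (place ω k).digitsBelow (k + 1) ∈
        stringSpace (critLeft B p) (critRight B p) s := by
      rwa [digitsBelow_succ (place_digit_of_le ω le_rfl), digitsBelow_place]
    rcases le_total k' (k + 1) with h | h
    · obtain ⟨n, hn⟩ := Int.le.dest h
      rw [← hn] at h0
      rw [← shift_iterate_digitsBelow _ _ n]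
      exact shift_iterate_mem_stringSpace h0 n
    · induction k', h using Int.leInduction with
      | base => exact h0
      | succ m hm ih =>
        rw [digitsBelow_succ (place_digit_of_le ω (by omega))]
        exact consZero_mem_of_zero hB hp ih (place_digit_of_le ω (by simp; omega))
  · intro h
    obtain ⟨K, hK⟩ := σ.exists_digit_eq_zero
    refine ⟨σ.digitsBelow K, ?_, K, (place_digitsBelow (hK K le_rfl)).symm⟩
    rw [mem_stringSpaceZero_iff, ← digitsBelow_succ (hK K le_rfl K le_rfl)]
    exact h _

theorem place_mem_decimalSpace_iff (hp : p ∈ Set.Icc (1 - 1 / B) (1 / B)) {s : Side}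
    {ω : BinString} {k : ℤ} :
    place ω k ∈ decimalSpace (critLeft B p) (critRight B p) s ↔
      consZero ω ∈ stringSpace (critLeft B p) (critRight B p) s := by
  refine ⟨fun h => ?_, fun h => ⟨ω, mem_stringSpaceZero_iff.2 h, k, rfl⟩⟩
  have := (mem_decimalSpace_iff hB hp).1 h (k + 1)
  rwa [digitsBelow_succ (place_digit_of_le ω le_rfl), digitsBelow_place] at this

theorem expansion_consZero (ω : BinString) :
    expansion B (consZero ω) = expansion B ω / B := by
  have h := expansion_shift hB (consZero ω)
  rw [shift_consZero, if_pos (show consZero ω 0 = 0 from rfl)] at h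
  rw [h, mul_div_cancel_left₀ _ (by positivity)]

omit hB in
theorem digitOf_eq_zero_of_le {s : Side} {x y : ℝ} (hxy : x ≤ y) (hy : digitOf p s y = 0) :
    digitOf p s x = 0 := by
  cases s
  · exact digitOf_minus_eq_zero.2 (hxy.trans (digitOf_minus_eq_zero.1 hy))
  · exact digitOf_plus_eq_zero.2 (hxy.trans_lt (digitOf_plus_eq_zero.1 hy))

theorem consZero_itinerary {s : Side} {y : ℝ} (h : digitOf p s (y / B) = 0) :
    consZero (itinerary B p s y) = itinerary B p s (y / B) := by
  have hB0 : B ≠ 0 := by positivity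
  ext n : 1
  cases n with
  | zero => exact h.symm
  | succ n =>
    have : stepMap B p s (y / B) = y := by rw [stepMap, if_pos h, mul_div_cancel₀ _ hB0]
    change digitOf p s _ = digitOf p s _
    rw [Function.iterate_succ_apply, this]

theorem consZero_itinerary_mem (hp : p ∈ Set.Icc (1 - 1 / B) (1 / B)) {s : Side} {y : ℝ}
    (hy : y ∈ Set.Icc (0 : ℝ) 1) (h : digitOf p s (y / B) = 0) :
    consZero (itinerary B p s y) ∈ stringSpace (critLeft B p) (critRight B p) s := by
  rw [consZero_itinerary hB h]
  exact itinerary_mem_stringSpace hB hp s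
    ⟨div_nonneg hy.1 (by linarith), (div_le_self hy.1 hB.le).trans hy.2⟩

/-- Let `x` be the expansion of `ω`; the hypothesis makes the digit of `x / B` zero. On the lower
branch the new point divided by `B` is `x`, of digit 0. On the upper branch the new point is at most
`x`, because `x ≤ 1`. -/
theorem consZero_shift_mem (hp : p ∈ Set.Icc (1 - 1 / B) (1 / B)) {s : Side} {ω : BinString}
    (h : consZero ω ∈ stringSpace (critLeft B p) (critRight B p) s) :
    consZero (shift ω) ∈ stringSpace (critLeft B p) (critRight B p) s := by
  have hB0 : 0 < B := by positivity
  have hω : ω ∈ stringSpace (critLeft B p) (critRight B p) s :=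
    shift_iterate_mem_stringSpace h 1
  have h1 := digitOf_expansion hB hp h
  rw [expansion_consZero hB, show consZero ω 0 = 0 from rfl] at h1
  have h2 := digitOf_expansion hB hp hω
  have hx := expansion_mem hB ω
  rw [← itinerary_expansion hB hp (ω := shift ω) (shift_iterate_mem_stringSpace hω 1)]
  refine consZero_itinerary_mem hB hp (expansion_mem hB _) ?_
  rw [expansion_shift hB]
  split_ifs with h3
  · rw [mul_div_cancel_left₀ _ hB0.ne', h2, h3]
  · refine digitOf_eq_zero_of_le ?_ h1
    rw [div_le_div_iff_of_pos_right hB0]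
    nlinarith [hx.2]

theorem shiftInvariant_decimalSpace (hp : p ∈ Set.Icc (1 - 1 / B) (1 / B)) (s : Side) :
    ShiftInvariant (decimalSpace (critLeft B p) (critRight B p) s) := by
  intro n
  ext σ
  constructor
  · rintro ⟨_, ⟨ω, ⟨k, hk⟩, rfl⟩, m, rfl⟩
    rw [place_mem_decimalSpace_iff hB hp] at hk ⊢
    induction n with
    | zero => exact hk
    | succ n ih =>
      rw [Function.iterate_succ_apply']
      exact consZero_shift_mem hB hp ih
  · intro h
    obtain ⟨K, hK⟩ := σ.exists_digit_eq_zero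
    -- Reading from `n` places higher, the shift removes only padding zeros. Membership does not
    -- depend on where the point stands, so it is put at 0.
    refine ⟨σ.digitsBelow K, ⟨σ.digitsBelow (K + n), ⟨0, ?_⟩, shift_iterate_digitsBelow σ K n⟩, K,
      (place_digitsBelow (hK K le_rfl)).symm⟩
    rw [place_mem_decimalSpace_iff hB hp, ← digitsBelow_succ (hK K le_rfl _ (by omega))]
    exact (mem_decimalSpace_iff hB hp).1 h _

theorem expansion_lt_of_toLex_lt (hp : p ∈ Set.Icc (1 - 1 / B) (1 / B)) {s : Side}
    {ω η : BinString} (hω : ω ∈ stringSpace (critLeft B p) (critRight B p) s)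
    (hη : η ∈ stringSpace (critLeft B p) (critRight B p) s) (h : toLex ω < toLex η) :
    expansion B ω < expansion B η := by
  by_contra! hc
  rw [← itinerary_expansion hB hp hω, ← itinerary_expansion hB hp hη] at h
  rcases hc.lt_or_eq with hlt | heq
  · exact lt_asymm h (itinerary_lt hB hp s s (expansion_mem hB η) (expansion_mem hB ω) hlt)
  · rw [heq] at h
    exact lt_irrefl _ h

theorem coe_radixMap_eq (hB₂ : B < 2) (hp : p ∈ Set.Icc (1 - 1 / B) (1 / B)) {s : Side}
    (σ : (pairSystem (critLeft B p) (critRight B p) s).addressSpace) {k : ℤ}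
    (h : ∀ n, k ≤ n → σ.1.digit n = 0) :
    ((pairSystem (critLeft B p) (critRight B p) s).radixMap σ : ℝ)
      = B ^ k / (B - 1) * expansion B (σ.1.digitsBelow k) := by
  change ∑' n : ℤ, ((σ.1.digit n : ℕ) : ℝ) * pairBase (critLeft B p) (critRight B p) ^ n = _
  rw [pairBase_crit hB hB₂ hp]
  exact (hasSum_digits hB h).tsum_eq

theorem isBinaryRadixSystem_crit (hB₂ : B < 2) (hp : p ∈ Set.Icc (1 - 1 / B) (1 / B)) (s : Side) :
    (pairSystem (critLeft B p) (critRight B p) s).IsBinaryRadixSystem := by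
  have hbase : (pairSystem (critLeft B p) (critRight B p) s).base = B := pairBase_crit hB hB₂ hp
  have hB0 : 0 < B := by positivity
  have hB1 : 0 < B - 1 := by linarith
  have hmem : ∀ (σ : (pairSystem (critLeft B p) (critRight B p) s).addressSpace) (k : ℤ),
      σ.1.digitsBelow k ∈ stringSpace (critLeft B p) (critRight B p) s :=
    fun σ => (mem_decimalSpace_iff hB hp).1 σ.2
  refine ⟨hbase.symm ▸ hB, shiftInvariant_decimalSpace hB hp s, ⟨?_, ?_⟩, ?_, ?_⟩
  · intro σ τ h
    obtain ⟨K, hK⟩ := σ.1.exists_digit_eq_zero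
    obtain ⟨L, hL⟩ := τ.1.exists_digit_eq_zero
    have hσ := hK _ (le_max_left K L)
    have hτ := hL _ (le_max_right K L)
    have h1 := congrArg NNReal.toReal h
    rw [coe_radixMap_eq hB hB₂ hp σ hσ, coe_radixMap_eq hB hB₂ hp τ hτ] at h1
    have h2 := mul_left_cancel₀ (by positivity) h1
    apply Subtype.ext
    rw [← place_digitsBelow hσ, ← place_digitsBelow hτ, ← itinerary_expansion hB hp (hmem σ _),
      ← itinerary_expansion hB hp (hmem τ _), h2]
  · intro v
    obtain ⟨-, -, hp0, hp1⟩ := param_bounds hB hp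
    -- Solving `v = B ^ k / (B - 1) * y` for `y`, with `k` so large that `y < p`; then a zero may be
    -- put before the itinerary of `y`.
    obtain ⟨k, hk⟩ := pow_unbounded_of_one_lt (v * (B - 1) / p) hB
    set y := v * (B - 1) / B ^ k with hy_def
    have hy0 : 0 ≤ y := by positivity
    have hyp : y < p := by
      rw [div_lt_iff₀ hp0] at hk
      rw [div_lt_iff₀ (by positivity), mul_comm p]
      exact hk
    have hy : y ∈ Set.Icc (0 : ℝ) 1 := ⟨hy0, (hyp.trans hp1).le⟩
    have hdig : digitOf p s (y / B) = 0 :=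
      digitOf_eq_zero_of_lt s ((div_le_self hy0 hB.le).trans_lt hyp)
    refine ⟨⟨place (itinerary B p s y) k,
      (place_mem_decimalSpace_iff hB hp).2 (consZero_itinerary_mem hB hp hy hdig)⟩, ?_⟩
    apply NNReal.eq
    rw [coe_radixMap_eq hB hB₂ hp _ fun n hn => place_digit_of_le _ hn, digitsBelow_place,
      expansion_itinerary hB hp s hy, hy_def, zpow_natCast]
    field_simp
  · rintro σ τ ⟨m, h1, h2⟩
    obtain ⟨K, hK⟩ := σ.1.exists_digit_eq_zero
    obtain ⟨L, hL⟩ := τ.1.exists_digit_eq_zero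
    set k := max (m + 1) (max K L) with hk
    have hσ := hK k ((le_max_left K L).trans (le_max_right _ _))
    have hτ := hL k ((le_max_right K L).trans (le_max_right _ _))
    have hm : m + 1 ≤ k := le_max_left _ _
    rw [← NNReal.coe_lt_coe, coe_radixMap_eq hB hB₂ hp σ hσ, coe_radixMap_eq hB hB₂ hp τ hτ]
    refine mul_lt_mul_of_pos_left ?_ (by positivity)
    refine expansion_lt_of_toLex_lt hB hp (hmem σ k) (hmem τ k)
      (toLex_lt_iff.2 ⟨(k - 1 - m).toNat, fun i hi => h1 _ (by omega), ?_⟩)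
    have : k - 1 - ((k - 1 - m).toNat : ℤ) = m := by omega
    simpa only [Decimal.digitsBelow, this] using h2
  · intro σ
    obtain ⟨K, hK⟩ := σ.1.exists_digit_eq_zero
    rw [coe_radixMap_eq hB hB₂ hp σ (hK K le_rfl), hbase]
    exact hasSum_digits hB (hK K le_rfl)

/-! ### Different parameters give different systems -/

theorem not_decimalSpace_subset_of_lt {p' : ℝ} (hp : p ∈ Set.Icc (1 - 1 / B) (1 / B))
    (hp' : p' ∈ Set.Icc (1 - 1 / B) (1 / B)) (h : p < p') (s : Side) :
    ¬ decimalSpace (critLeft B p') (critRight B p') s ⊆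
      decimalSpace (critLeft B p) (critRight B p) s := by
  intro hsub
  have hB0 : 0 < B := by positivity
  obtain ⟨-, -, hp0, -⟩ := param_bounds hB hp
  obtain ⟨-, hBp, -, -⟩ := param_bounds hB hp'
  -- The itinerary of `q` for the parameter `p'` starts with 0 and expands to `q > p`, too large for
  -- a string with leading 0 in the space of `p`. Without that 0 it is the itinerary of `B * q`.
  obtain ⟨q, hq, hq'⟩ := exists_between h
  have hy : B * q ∈ Set.Icc (0 : ℝ) 1 :=
    ⟨mul_nonneg hB0.le (by linarith), (mul_le_mul_of_nonneg_left hq'.le hB0.le).trans hBp⟩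
  have hdig : digitOf p' s (B * q / B) = 0 := by
    rw [mul_div_cancel_left₀ _ hB0.ne']
    exact digitOf_eq_zero_of_lt s hq'
  have h1 := (place_mem_decimalSpace_iff hB hp).1
    (hsub ((place_mem_decimalSpace_iff hB hp' (k := 0)).2 (consZero_itinerary_mem hB hp' hy hdig)))
  have h2 := (expansion_le_of_zero_and_ge_of_one hB hp h1).1 rfl
  rw [expansion_consZero hB, expansion_itinerary hB hp' s hy, mul_div_cancel_left₀ _ hB0.ne'] at h2
  linarith

theorem injOn_pairSystem_crit (s : Side) :
    Set.InjOn (fun p : ℝ => pairSystem (critLeft B p) (critRight B p) s)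
      (Set.Icc (1 - 1 / B) (1 / B)) := by
  intro p hp p' hp' h
  have h1 : decimalSpace (critLeft B p) (critRight B p) s
      = decimalSpace (critLeft B p') (critRight B p') s := congrArg RadixTriple.addressSpace h
  rcases lt_trichotomy p p' with hlt | heq | hgt
  · exact absurd h1.ge (not_decimalSpace_subset_of_lt hB hp hp' hlt s)
  · exact heq
  · exact absurd h1.le (not_decimalSpace_subset_of_lt hB hp' hp hgt s)

end Systems

end BinaryRadix

theorem mainTheorem4 (B : ℝ) (hB₁ : 1 < B) (hB₂ : B < 2) :
    {R : BinaryRadix.RadixTriple | R.IsBinaryRadixSystem ∧ R.base = B}.Infinite ∧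
    (∀ p ∈ Set.Icc (1 - 1 / B) (1 / B),
      BinaryRadix.Admissible (BinaryRadix.critLeft B p) (BinaryRadix.critRight B p) ∧
      ¬ BinaryRadix.IsNull (BinaryRadix.critLeft B p) (BinaryRadix.critRight B p) ∧
      IsLeast (BinaryRadix.solutions (BinaryRadix.critLeft B p) (BinaryRadix.critRight B p))
        (1 / B) ∧
      ∀ s : BinaryRadix.Side,
        (BinaryRadix.pairSystem (BinaryRadix.critLeft B p)
          (BinaryRadix.critRight B p) s).IsBinaryRadixSystem ∧
        (BinaryRadix.pairSystem (BinaryRadix.critLeft B p)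
          (BinaryRadix.critRight B p) s).base = B) ∧
    (∀ s : BinaryRadix.Side,
      Set.InjOn
        (fun p : ℝ => BinaryRadix.pairSystem (BinaryRadix.critLeft B p)
          (BinaryRadix.critRight B p) s)
        (Set.Icc (1 - 1 / B) (1 / B))) := by
  have hB0 : 0 < B := by positivity
  refine ⟨?_, fun p hp => ⟨BinaryRadix.admissible_crit hB₁ hp, BinaryRadix.not_isNull_crit hB₁ hp,
    BinaryRadix.isLeast_solutions hB₁ hB₂ hp, fun s =>
      ⟨BinaryRadix.isBinaryRadixSystem_crit hB₁ hB₂ hp s, BinaryRadix.pairBase_crit hB₁ hB₂ hp⟩⟩,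
    BinaryRadix.injOn_pairSystem_crit hB₁⟩
  -- Here `B < 2` makes the parameter interval nondegenerate, hence infinite.
  have hlt : 1 - 1 / B < 1 / B := by
    have := (lt_div_iff₀ hB0).2 (show 1 / 2 * B < 1 by linarith)
    linarith
  exact Set.infinite_of_injOn_mapsTo (BinaryRadix.injOn_pairSystem_crit hB₁ .minus)
    (fun p hp => ⟨BinaryRadix.isBinaryRadixSystem_crit hB₁ hB₂ hp .minus,
      BinaryRadix.pairBase_crit hB₁ hB₂ hp⟩) (Set.Icc_infinite hlt)
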